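/- Let $p$ be an odd prime, $d\ge 1$, $q=p^d$, and let $\mathbb{F}_q$ be the finite field with $q$ elements. Let $M_q$ be the number of $\alpha\in\mathbb{F}_q$ such that $\alpha-1,\alpha,\alpha+1$ are all non-zero squares in $\mathbb{F}_q$, and let $N_q$ be the number of $\alpha\in\mathbb{F}_q$ such that $\alpha-1,\alpha,\alpha+1$ are all non-squares in $\mathbb{F}_q$. 1. If $q\equiv 7\pmod 8$, then $M_q=N_q=\frac{q-7}{8}$. 2. If $q\equiv 3\pmod 8$, then $M_q=N_q=\frac{q-3}{8}$. 3. If $q\equiv 5\pmod 8$, then there are integers $s,t$ with $q=s^2+t^2$, $p\nmid s$, $s\equiv 1\pmod 4$; here $s$ is uniquely determined (and $t$ is determined up to sign), and $$M_q=\frac{q+2s-7}{8},\qquad N_q=\frac{q-2s-3}{8}.$$ 4. If $q\equiv 1\pmod 8$ and $p\equiv 1\pmod 4$, then integers $s,t$ as in 3 exist, with $s$ uniquely determined (and $t$ up to sign), and $$M_q=\frac{q-2s-15}{8},\qquad N_q=\frac{q+2s-3}{8}.$$ 5. If $q\equiv 1\pmod 8$ and $p\equiv 3\pmod 4$, then $q$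 is a square, $d$ is even, and $$M_q=\frac18\left(q-2(-1)^{d/2}\sqrt q-15\right),\qquad N_q=\frac18\left(q+2(-1)^{d/2}\sqrt q-3\right).$$ -/

import Mathlib

/-- The number of `α` in `F` for which `α - 1`, `α`, `α + 1` are all non-zero squares. -/
noncomputable def numSquareTriples (F : Type*) [Field F] : ℕ :=
  Nat.card {α : F // (α - 1 ≠ 0 ∧ IsSquare (α - 1)) ∧ (α ≠ 0 ∧ IsSquare α) ∧
    (α + 1 ≠ 0 ∧ IsSquare (α + 1))}

/-- The number of `α` in `F` for which `α - 1`, `α`, `α + 1` are all non-squares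
(`0` is a square). -/
noncomputable def numNonsquareTriples (F : Type*) [Field F] : ℕ :=
  Nat.card {α : F // ¬ IsSquare (α - 1) ∧ ¬ IsSquare α ∧ ¬ IsSquare (α + 1)}

/-- The conditions `q = s² + t²`, `p ∤ s`, `s ≡ 1 (mod 4)` on integers `s`, `t`. -/
def IsTwoSquareRep (p q : ℕ) (s t : ℤ) : Prop :=
  (q : ℤ) = s ^ 2 + t ^ 2 ∧ ¬ (p : ℤ) ∣ s ∧ s ≡ 1 [ZMOD 4]

/-! Write η for the quadratic character and S(k) = ∑ η(x³ - kx). Away from x = 0, ±1, the product of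
the factors 1 + eη(x + i), i = -1, 0, 1, is 8 times the indicator that all three values equal e.
Summing it gives 8M and 8N as q ± S(1) plus elementary terms.

If q ≡ 3 mod 4, then S(1) = 0 because x³ - x is odd. If q ≡ 1 mod 4, a second moment over k gives
S(1)² + S(g)² = 4q for a non-square g (`cubicCharSum_one_sq_add_sq`), so S(1) = 2a with q = a² + b².
Integrality of N fixes a mod 4. For p ≡ 1 mod 4, p ∤ S(1) by a binomial congruence, which singles
out one representation of q; for p ≡ 3 mod 4, descent leaves only a = ±√q. -/

/-! ### Quadratic and cubic character sums -/

section QuadraticCharacterSums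

variable {F : Type*} [Field F] [Fintype F] [DecidableEq F]

/-- The character sum `∑ η(x³ - k x)` over a finite field, `η` being the quadratic character. -/
noncomputable def cubicCharSum (F : Type*) [Field F] [Fintype F] [DecidableEq F] (k : F) : ℤ :=
  ∑ x : F, quadraticChar F (x ^ 3 - k * x)

theorem sum_quadraticChar_mul_sub_one (hF : ringChar F ≠ 2) :
    ∑ u : F, quadraticChar F (u * (u - 1)) = -1 := by
  have h := jacobiSum_nontrivial_inv (quadraticChar_ne_one hF)
  rw [(quadraticChar_isQuadratic F).inv, jacobiSum] at h
  have h1 : quadraticChar F (-1) * quadraticChar F (-1) = 1 := by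
    rw [← map_mul]; simp
  calc ∑ u : F, quadraticChar F (u * (u - 1))
      = quadraticChar F (-1) * ∑ u : F, quadraticChar F u * quadraticChar F (1 - u) := by
        rw [Finset.mul_sum]
        refine Finset.sum_congr rfl fun u _ => ?_
        rw [← map_mul, ← map_mul]
        congr 1; ring
    _ = -1 := by rw [h]; linarith

theorem sum_quadraticChar_sub_mul_sub (hF : ringChar F ≠ 2) (a b : F) :
    ∑ k : F, quadraticChar F ((k - a) * (k - b)) =
      (if a = b then (Fintype.card F : ℤ) else 0) - 1 := by
  split_ifs with hab
  · subst hab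
    have h : ∀ k : F, quadraticChar F ((k - a) * (k - a)) = 1 - if k = a then 1 else 0 := by
      intro k
      split_ifs with hk
      · simp [hk]
      · rw [← sq, quadraticChar_sq_one' (sub_ne_zero.2 hk)]; simp
    simp [h, Finset.sum_sub_distrib]
  · have hba : b - a ≠ 0 := sub_ne_zero.2 (Ne.symm hab)
    rw [zero_sub, ← sum_quadraticChar_mul_sub_one hF]
    symm
    refine Fintype.sum_equiv ((Equiv.mulLeft₀ (b - a) hba).trans (Equiv.addRight a)) _ _ fun u => ?_
    have : ((Equiv.mulLeft₀ (b - a) hba).trans (Equiv.addRight a)) u = (b - a) * u + a := rfl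
    rw [this, show ((b - a) * u + a - a) * ((b - a) * u + a - b) = (b - a) ^ 2 * (u * (u - 1)) by
      ring, map_mul _ ((b - a) ^ 2), quadraticChar_sq_one' hba, one_mul]

/-- Each k has 1 + η(k) square roots. -/
theorem sum_comp_sq (hF : ringChar F ≠ 2) (f : F → ℤ) :
    ∑ m : F, f (m ^ 2) = ∑ k : F, (1 + quadraticChar F k) * f k := by
  rw [← Finset.sum_fiberwise Finset.univ (fun m : F => m ^ 2) (fun m => f (m ^ 2))]
  refine Finset.sum_congr rfl fun k _ => ?_
  have h := quadraticChar_card_sqrts hF k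
  rw [Finset.sum_congr rfl (g := fun _ => f k), Finset.sum_const, nsmul_eq_mul, add_comm 1, ← h]
  · congr 2
    simp
  · intro x hx
    rw [(Finset.mem_filter.1 hx).2]

theorem cubicCharSum_mul_sq {m : F} (hm : m ≠ 0) (k : F) :
    cubicCharSum F (k * m ^ 2) = quadraticChar F m * cubicCharSum F k := by
  rw [cubicCharSum, cubicCharSum, Finset.mul_sum]
  symm
  refine Fintype.sum_equiv (Equiv.mulLeft₀ m hm) _ _ fun x => ?_
  have : Equiv.mulLeft₀ m hm x = m * x := rfl
  rw [this, show (m * x) ^ 3 - k * m ^ 2 * (m * x) = m ^ 2 * (m * (x ^ 3 - k * x)) by ring,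
    map_mul _ (m ^ 2), quadraticChar_sq_one' hm, one_mul, map_mul]

theorem cubicCharSum_zero (hF : ringChar F ≠ 2) : cubicCharSum F 0 = 0 := by
  rw [cubicCharSum, ← quadraticChar_sum_zero hF]
  refine Finset.sum_congr rfl fun x _ => ?_
  rcases eq_or_ne x 0 with rfl | hx
  · simp
  · rw [show x ^ 3 - 0 * x = x ^ 2 * x by ring, map_mul, quadraticChar_sq_one' hx, one_mul]

theorem cubicCharSum_eq_zero (h1 : quadraticChar F (-1) = -1) (k : F) : cubicCharSum F k = 0 := by
  have h : cubicCharSum F k = -cubicCharSum F k := by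
    conv_rhs => rw [cubicCharSum, ← Finset.sum_neg_distrib]
    refine Fintype.sum_equiv (Equiv.neg F) _ _ fun x => ?_
    rw [Equiv.neg_apply, show (-x) ^ 3 - k * -x = -1 * (x ^ 3 - k * x) by ring, map_mul, h1]
    ring
  omega

theorem sum_quadraticChar_sq_eq_sq (hF : ringChar F ≠ 2) (h1 : quadraticChar F (-1) = 1) (x : F) :
    ∑ y : F, (if x ^ 2 = y ^ 2 then quadraticChar F (x * y) else 0) =
      if x = 0 then 0 else 2 := by
  split_ifs with hx
  · subst hx; simp
  · have hne : x ≠ -x := fun h => hx <| by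
      have h2 : (2 : F) * x = 0 := by linear_combination h
      exact (mul_eq_zero.1 h2).resolve_left (Ring.two_ne_zero hF)
    have : ∀ y : F, (if x ^ 2 = y ^ 2 then quadraticChar F (x * y) else 0) =
        (if y = x then 1 else 0) + (if y = -x then 1 else 0) := by
      intro y
      by_cases hy : y = x
      · subst hy
        rw [if_pos rfl, if_pos rfl, if_neg hne, ← sq, quadraticChar_sq_one' hx, add_zero]
      · by_cases hy' : y = -x
        · subst hy'
          rw [if_pos (by ring), if_neg hy, if_pos rfl, show x * -x = -1 * x ^ 2 by ring, map_mul, h1,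
            quadraticChar_sq_one' hx]
          simp
        · rw [if_neg hy, if_neg hy', if_neg, add_zero]
          intro h
          rcases sq_eq_sq_iff_eq_or_eq_neg.1 h with h | h
          · exact hy h.symm
          · exact hy' (by rw [h, neg_neg])
    rw [Finset.sum_congr rfl fun y _ => this y, Finset.sum_add_distrib]
    simp

/-- After expanding the square, the sum over k is q[x² = y²] - 1. The -1 terms cancel since ∑ η = 0,
leaving the pairs y = ±x. -/
theorem sum_cubicCharSum_sq (hF : ringChar F ≠ 2) (h1 : quadraticChar F (-1) = 1) :
    ∑ k : F, cubicCharSum F k ^ 2 = 2 * Fintype.card F * ((Fintype.card F : ℤ) - 1) := by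
  have hk : ∀ k : F, cubicCharSum F k ^ 2 =
      ∑ x : F, ∑ y : F, quadraticChar F (x * y) *
        quadraticChar F ((k - x ^ 2) * (k - y ^ 2)) := by
    intro k
    rw [sq, cubicCharSum, Finset.sum_mul_sum]
    refine Finset.sum_congr rfl fun x _ => Finset.sum_congr rfl fun y _ => ?_
    rw [← map_mul, ← map_mul]
    congr 1; ring
  rw [Finset.sum_congr rfl fun k _ => hk k, Finset.sum_comm]
  have hx : ∀ x : F, ∑ k : F, ∑ y : F, quadraticChar F (x * y) *
      quadraticChar F ((k - x ^ 2) * (k - y ^ 2)) =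
        Fintype.card F * (2 - if x = 0 then 2 else 0) := by
    intro x
    have hy : ∀ y : F, ∑ k : F, quadraticChar F (x * y) *
      quadraticChar F ((k - x ^ 2) * (k - y ^ 2)) =
        Fintype.card F * (if x ^ 2 = y ^ 2 then quadraticChar F (x * y) else 0) -
          quadraticChar F x * quadraticChar F y := by
      intro y
      rw [← Finset.mul_sum, sum_quadraticChar_sub_mul_sub hF, map_mul]
      split_ifs <;> ring
    rw [Finset.sum_comm, Finset.sum_congr rfl fun y _ => hy y, Finset.sum_sub_distrib,
      ← Finset.mul_sum, ← Finset.mul_sum, quadraticChar_sum_zero hF,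
      sum_quadraticChar_sq_eq_sq hF h1]
    split_ifs <;> ring
  rw [Finset.sum_congr rfl fun x _ => hx x, ← Finset.mul_sum, Finset.sum_sub_distrib]
  simp
  ring

/-- S(k)² is constant on each of the two square classes of non-zero k, so the second moment is (q -
1)/2 times the left side. -/
theorem cubicCharSum_one_sq_add_sq (hF : ringChar F ≠ 2) (h1 : quadraticChar F (-1) = 1)
    {g : F} (hg : quadraticChar F g = -1) :
    cubicCharSum F 1 ^ 2 + cubicCharSum F g ^ 2 = 4 * Fintype.card F := by
  have hg0 : g ≠ 0 := by rintro rfl; simp at hg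
  have hsq : ∀ k m : F, cubicCharSum F (k * m ^ 2) ^ 2 =
      cubicCharSum F k ^ 2 - if m = 0 then cubicCharSum F k ^ 2 else 0 := by
    intro k m
    split_ifs with hm
    · simp [hm, cubicCharSum_zero hF]
    · rw [cubicCharSum_mul_sq hm, mul_pow, quadraticChar_sq_one hm]; ring
  have hsum : ∀ k : F, ∑ m : F, cubicCharSum F (k * m ^ 2) ^ 2 =
      (Fintype.card F - 1) * cubicCharSum F k ^ 2 := by
    intro k
    rw [Finset.sum_congr rfl fun m _ => hsq k m, Finset.sum_sub_distrib]
    simp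
    ring
  have e1 := sum_comp_sq hF fun k => cubicCharSum F (1 * k) ^ 2
  have e2 := sum_comp_sq hF fun k => cubicCharSum F (g * k) ^ 2
  simp only [hsum] at e1 e2
  have e3 : ∑ k : F, (1 + quadraticChar F k) * cubicCharSum F (g * k) ^ 2 =
      ∑ k : F, (1 - quadraticChar F k) * cubicCharSum F k ^ 2 := by
    refine Fintype.sum_equiv (Equiv.mulLeft₀ g hg0) _ _ fun k => ?_
    have : Equiv.mulLeft₀ g hg0 k = g * k := rfl
    rw [this, map_mul, hg]
    ring
  have e4 : ((Fintype.card F : ℤ) - 1) * (cubicCharSum F 1 ^ 2 + cubicCharSum F g ^ 2) =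
      (Fintype.card F - 1) * (4 * Fintype.card F) := by
    rw [mul_add, e1, e2, e3, ← Finset.sum_add_distrib]
    rw [Finset.sum_congr rfl (g := fun k : F => 2 * cubicCharSum F k ^ 2) fun k _ => by
      rw [one_mul]; ring, ← Finset.mul_sum, sum_cubicCharSum_sq hF h1]
    ring
  have hc : (Fintype.card F : ℤ) - 1 ≠ 0 := by
    have : 1 < Fintype.card F := Fintype.one_lt_card
    omega
  exact mul_left_cancel₀ hc e4

end QuadraticCharacterSums

/-! ### Triple counts in terms of S(1) -/

section CountingTriples

variable {F : Type*} [Field F] [Fintype F] [DecidableEq F]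

theorem sum_triple_product (hF : ringChar F ≠ 2) (e : ℤ) :
    ∑ x : F, (1 + e * quadraticChar F (x - 1)) * (1 + e * quadraticChar F x) *
      (1 + e * quadraticChar F (x + 1)) =
        Fintype.card F - 3 * e ^ 2 + e ^ 3 * cubicCharSum F 1 := by
  have hne : (1 : F) ≠ -1 := fun h => Ring.neg_one_ne_one_of_char_ne_two hF h.symm
  have h0 := quadraticChar_sum_zero hF
  have s1 : ∑ x : F, quadraticChar F (x - 1) = 0 := by
    rw [← h0]; exact Equiv.sum_comp (Equiv.subRight (1 : F)) fun x => quadraticChar F x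
  have s2 : ∑ x : F, quadraticChar F (x + 1) = 0 := by
    rw [← h0]; exact Equiv.sum_comp (Equiv.addRight (1 : F)) fun x => quadraticChar F x
  have p1 := sum_quadraticChar_sub_mul_sub hF 1 0
  have p2 := sum_quadraticChar_sub_mul_sub hF 0 (-1)
  have p3 := sum_quadraticChar_sub_mul_sub hF 1 (-1)
  rw [if_neg one_ne_zero] at p1
  rw [if_neg (neg_ne_zero.2 one_ne_zero).symm] at p2
  rw [if_neg hne] at p3
  have hx : ∀ x : F, (1 + e * quadraticChar F (x - 1)) * (1 + e * quadraticChar F x) *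
      (1 + e * quadraticChar F (x + 1)) =
      1 + e * (quadraticChar F (x - 1) + quadraticChar F x + quadraticChar F (x + 1)) +
      e ^ 2 * (quadraticChar F ((x - 1) * (x - 0)) + quadraticChar F ((x - 0) * (x - -1)) +
        quadraticChar F ((x - 1) * (x - -1))) + e ^ 3 * quadraticChar F (x ^ 3 - 1 * x) := by
    intro x
    rw [show x ^ 3 - 1 * x = (x - 1) * x * (x + 1) by ring]
    simp only [map_mul, sub_zero, sub_neg_eq_add]
    ring
  simp only [hx, Finset.sum_add_distrib, ← Finset.mul_sum, s1, s2, h0, p1, p2, p3]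
  simp only [cubicCharSum, Finset.sum_const, Finset.card_univ, nsmul_eq_mul]
  ring

theorem ne_zero_and_isSquare_iff (x : F) : (x ≠ 0 ∧ IsSquare x) ↔ quadraticChar F x = 1 := by
  constructor
  · rintro ⟨h, hs⟩
    exact (quadraticChar_one_iff_isSquare h).2 hs
  · intro h
    have hx : x ≠ 0 := by rintro rfl; simp at h
    exact ⟨hx, (quadraticChar_one_iff_isSquare hx).1 h⟩

theorem numSquareTriples_eq_sum : (numSquareTriples F : ℤ) =
    ∑ x : F, if quadraticChar F (x - 1) = 1 ∧ quadraticChar F x = 1 ∧ quadraticChar F (x + 1) = 1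
      then 1 else 0 := by
  rw [numSquareTriples, Nat.card_eq_fintype_card, Fintype.card_subtype, Finset.sum_boole]
  simp only [ne_zero_and_isSquare_iff]

theorem numNonsquareTriples_eq_sum : (numNonsquareTriples F : ℤ) =
    ∑ x : F, if quadraticChar F (x - 1) = -1 ∧ quadraticChar F x = -1 ∧
      quadraticChar F (x + 1) = -1 then 1 else 0 := by
  rw [numNonsquareTriples, Nat.card_eq_fintype_card, Fintype.card_subtype, Finset.sum_boole]
  simp only [quadraticChar_neg_one_iff_not_isSquare]

/-- At 0, ±1 one character value vanishes, so the indicator is 0 and the remaining two factors form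
the correction. -/
theorem triple_product_eq (hF : ringChar F ≠ 2) {e : ℤ} (he : e = 1 ∨ e = -1) (x : F) :
    (1 + e * quadraticChar F (x - 1)) * (1 + e * quadraticChar F x) *
      (1 + e * quadraticChar F (x + 1)) =
    8 * (if quadraticChar F (x - 1) = e ∧ quadraticChar F x = e ∧ quadraticChar F (x + 1) = e
      then 1 else 0) +
    (if x = 0 then (1 + e * quadraticChar F (-1)) * (1 + e) else 0) +
    (if x = 1 then (1 + e) * (1 + e * quadraticChar F 2) else 0) +
    (if x = -1 then (1 + e * quadraticChar F (-2)) * (1 + e * quadraticChar F (-1)) else 0) := by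
  have hne : (1 : F) ≠ -1 := fun h => Ring.neg_one_ne_one_of_char_ne_two hF h.symm
  have he0 : e ≠ 0 := by rcases he with rfl | rfl <;> decide
  have h10 : (-1 : F) ≠ 0 := neg_ne_zero.2 one_ne_zero
  by_cases h0 : x = 0
  · subst h0
    simp [he0.symm, h10.symm]
  by_cases h1 : x = 1
  · subst h1
    simp [he0.symm, hne, one_add_one_eq_two]
  by_cases h2 : x = -1
  · subst h2
    simp [he0.symm, hne.symm, show (-1 - 1 : F) = -2 by ring]
  rcases quadraticChar_dichotomy (sub_ne_zero.2 h1) with a | a <;>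
  rcases quadraticChar_dichotomy h0 with b | b <;>
  rcases quadraticChar_dichotomy (a := x + 1) (fun h => h2 (eq_neg_of_add_eq_zero_left h))
    with c | c <;> rcases he with rfl | rfl <;> simp [a, b, c, h0, h1, h2]

theorem eight_mul_numSquareTriples (hF : ringChar F ≠ 2) :
    8 * (numSquareTriples F : ℤ) = Fintype.card F - 3 + cubicCharSum F 1 -
      2 * (1 + quadraticChar F (-1)) - 2 * (1 + quadraticChar F 2) -
      (1 + quadraticChar F (-2)) * (1 + quadraticChar F (-1)) := by
  have h := sum_triple_product hF 1
  simp only [triple_product_eq hF (Or.inl rfl), Finset.sum_add_distrib, ← Finset.mul_sum,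
    ← numSquareTriples_eq_sum, Finset.sum_ite_eq', Finset.mem_univ, if_true] at h
  linarith

theorem eight_mul_numNonsquareTriples (hF : ringChar F ≠ 2) :
    8 * (numNonsquareTriples F : ℤ) = Fintype.card F - 3 - cubicCharSum F 1 -
      (1 - quadraticChar F (-2)) * (1 - quadraticChar F (-1)) := by
  have h := sum_triple_product hF (-1)
  simp only [triple_product_eq hF (Or.inr rfl), Finset.sum_add_distrib, ← Finset.mul_sum,
    ← numNonsquareTriples_eq_sum, Finset.sum_ite_eq', Finset.mem_univ, if_true] at h
  linarith

end CountingTriples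

/-! ### S(1) modulo p -/

section ResidueOfCubicSum

/-- Lucas: all d base-p digits of the two entries are (p - 1)/2 and (p - 1)/4. The induction strips
the lowest digit. -/
theorem not_dvd_choose_half_quarter {p : ℕ} (hp : p.Prime) (hp4 : p % 4 = 1) (d : ℕ) :
    ¬ p ∣ (p ^ d / 2).choose (p ^ d / 4) := by
  have := Fact.mk hp
  obtain ⟨r, hr⟩ : ∃ r, p = 4 * r + 1 := ⟨p / 4, by omega⟩
  induction d with
  | zero => simpa using hp.one_lt.ne'
  | succ d ih =>
    obtain ⟨m, hm⟩ : ∃ m, p ^ d = 4 * m + 1 := by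
      have h : p ^ d % 4 = 1 := by rw [Nat.pow_mod, hp4]; simp
      exact ⟨p ^ d / 4, by omega⟩
    have e2 : p ^ (d + 1) / 2 = 2 * r + p * (2 * m) := by
      rw [pow_succ, hm, show (4 * m + 1) * p = 2 * (p * (2 * m)) + p by ring]; omega
    have e4 : p ^ (d + 1) / 4 = r + p * m := by
      rw [pow_succ, hm, show (4 * m + 1) * p = 4 * (p * m) + p by ring]; omega
    have f2 : p ^ d / 2 = 2 * m := by omega
    have f4 : p ^ d / 4 = m := by omega
    rw [f2, f4] at ih
    have h := Choose.choose_modEq_choose_mod_mul_choose_div_nat (p := p)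
      (n := p ^ (d + 1) / 2) (k := p ^ (d + 1) / 4)
    rw [e2, e4, Nat.add_mul_mod_self_left, Nat.add_mul_mod_self_left,
      Nat.add_mul_div_left _ _ hp.pos, Nat.add_mul_div_left _ _ hp.pos,
      Nat.mod_eq_of_lt (by omega : 2 * r < p), Nat.mod_eq_of_lt (by omega : r < p),
      Nat.div_eq_of_lt (by omega : 2 * r < p), Nat.div_eq_of_lt (by omega : r < p),
      zero_add, zero_add] at h
    rw [e2, e4, h.dvd_iff dvd_rfl, hp.dvd_mul, not_or]
    refine ⟨fun hd => ?_, ih⟩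
    have hf : p ∣ (2 * r).factorial := by
      rw [← Nat.choose_mul_factorial_mul_factorial (by omega : r ≤ 2 * r)]
      exact (hd.mul_right _).mul_right _
    have := hp.dvd_factorial.1 hf
    omega

variable {F : Type*} [Field F] [Fintype F]

theorem sum_pow_eq_ite {i : ℕ} (hi : i ≠ 0) :
    ∑ x : F, x ^ i = if Fintype.card F - 1 ∣ i then -1 else 0 := by
  classical
  rw [← FiniteField.sum_pow_units F i, ← Finset.sum_sdiff (Finset.subset_univ {(0 : F)})]
  simp only [Finset.sum_singleton, zero_pow hi, add_zero]
  symm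
  refine Finset.sum_bij (fun (x : Fˣ) _ => (x : F)) ?_ ?_ ?_ ?_
  · simp
  · intro a _ b _ h; exact Units.ext h
  · intro b hb
    simp only [Finset.mem_sdiff, Finset.mem_univ, Finset.mem_singleton, true_and] at hb
    exact ⟨Units.mk0 b hb, Finset.mem_univ _, rfl⟩
  · simp

/-- By Euler's criterion η(y) = y^((q-1)/2) in `F`; expand and use power sums. -/
theorem cubicCharSum_one_cast [DecidableEq F] (hF : ringChar F ≠ 2)
    (h4 : Fintype.card F % 4 = 1) :
    (cubicCharSum F 1 : F) = -((-1) ^ (Fintype.card F / 4) *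
      ((Fintype.card F / 2).choose (Fintype.card F / 4) : F)) := by
  obtain ⟨r, hr⟩ : ∃ r, Fintype.card F = 4 * r + 1 := ⟨Fintype.card F / 4, by omega⟩
  have hr0 : r ≠ 0 := by
    have : 1 < Fintype.card F := Fintype.one_lt_card
    omega
  have e2 : Fintype.card F / 2 = 2 * r := by omega
  have e4 : Fintype.card F / 4 = r := by omega
  rw [cubicCharSum, Int.cast_sum]
  simp only [quadraticChar_eq_pow_of_char_ne_two' hF, e2, e4]
  have hx : ∀ x : F, (x ^ 3 - 1 * x) ^ (2 * r) =
      ∑ j ∈ Finset.range (2 * r + 1),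
        (-1) ^ (2 * r - j) * ((2 * r).choose j : F) * x ^ (2 * j + 2 * r) := by
    intro x
    rw [show x ^ 3 - 1 * x = x * (x ^ 2 + -1) by ring, mul_pow, add_pow, Finset.mul_sum]
    refine Finset.sum_congr rfl fun j _ => ?_
    rw [pow_add, pow_mul]
    ring
  rw [Finset.sum_congr rfl fun x _ => hx x, Finset.sum_comm]
  simp only [← Finset.mul_sum]
  rw [Finset.sum_eq_single r]
  · rw [sum_pow_eq_ite (by omega), if_pos (by rw [hr]; exact ⟨1, by omega⟩),
      show 2 * r - r = r by omega]
    ring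
  · intro j hj hjr
    rw [Finset.mem_range] at hj
    -- The exponent lies in [2r, 6r], where the only multiple of q - 1 = 4r is 4r itself, at j = r.
    rw [sum_pow_eq_ite (by omega), if_neg, mul_zero]
    rintro ⟨c, hc⟩
    rw [hr, Nat.add_sub_cancel] at hc
    have hc2 : c < 2 := by
      by_contra hc2
      have : 4 * r * 2 ≤ 4 * r * c := Nat.mul_le_mul_left _ (by omega)
      omega
    interval_cases c <;> omega
  · intro h
    exact absurd (Finset.mem_range.2 (by omega)) h

theorem not_dvd_cubicCharSum_one [DecidableEq F] {p d : ℕ} (hp : p.Prime) (hp4 : p % 4 = 1)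
    (hF : Fintype.card F = p ^ d) : ¬ (p : ℤ) ∣ cubicCharSum F 1 := by
  have := Fact.mk hp
  have : CharP F p := charP_of_card_eq_prime_pow hF
  have hchar : ringChar F ≠ 2 := by
    rw [ringChar.eq F p]; rintro rfl; omega
  rw [← CharP.intCast_eq_zero_iff F p,
    cubicCharSum_one_cast hchar (by rw [hF, Nat.pow_mod, hp4]; simp), neg_eq_zero, hF]
  refine mul_ne_zero (pow_ne_zero _ (neg_ne_zero.2 one_ne_zero)) ?_
  rw [Ne, CharP.cast_eq_zero_iff F p]
  exact not_dvd_choose_half_quarter hp hp4 d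

end ResidueOfCubicSum

/-! ### Representations of prime powers as two squares -/

section TwoSquares

/-- p^d divides (su - tv)(su + tv), and p cannot divide both factors, as their sum is 2su. So p^d
divides one of them, and the two-squares identity then forces sv = ±tu. -/
theorem sq_eq_sq_of_sq_add_sq_eq_prime_pow {p d : ℕ} (hp : p.Prime) (hp2 : p ≠ 2)
    {s t u v : ℤ} (h1 : (p : ℤ) ^ d = s ^ 2 + t ^ 2) (h2 : (p : ℤ) ^ d = u ^ 2 + v ^ 2)
    (hs : ¬ (p : ℤ) ∣ s) (hu : ¬ (p : ℤ) ∣ u) (hso : s % 2 = 1) (huo : u % 2 = 1) :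
    s ^ 2 = u ^ 2 := by
  have hpp : Prime (p : ℤ) := Nat.prime_iff_prime_int.1 hp
  have hq : (0 : ℤ) < (p : ℤ) ^ d := pow_pos (by exact_mod_cast hp.pos) d
  have hodd : ((p : ℤ) ^ d) % 2 = 1 := by
    have : Odd ((p : ℤ) ^ d) := Odd.pow (by exact_mod_cast hp.odd_of_ne_two hp2)
    exact Int.odd_iff.1 this
  have key : ∀ v : ℤ, (p : ℤ) ^ d = u ^ 2 + v ^ 2 → (p : ℤ) ^ d ∣ s * u + t * v →
      s ^ 2 = u ^ 2 := by
    intro v h2 hd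
    obtain ⟨c, hc⟩ := hd
    have ht : t % 2 = 0 := by
      by_contra ht
      have : s ^ 2 % 2 = 1 := by rw [sq, Int.mul_emod, hso]; rfl
      have : t ^ 2 % 2 = 1 := by rw [sq, Int.mul_emod, Int.emod_two_ne_zero.1 ht]; rfl
      omega
    -- Here s and u are odd and t is even, so su + tv is odd.
    have hne : s * u + t * v ≠ 0 := by
      intro h0
      have : s * u % 2 = 1 := by rw [Int.mul_emod, hso, huo]; rfl
      have : t * v % 2 = 0 := by rw [Int.mul_emod, ht]; simp
      omega
    have hid : (s * u + t * v) ^ 2 + (s * v - t * u) ^ 2 = ((p : ℤ) ^ d) ^ 2 := by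
      nth_rewrite 1 [sq ((p : ℤ) ^ d)]
      nth_rewrite 1 [h1]
      rw [h2]; ring
    set Q := (p : ℤ) ^ d
    have hc0 : c ≠ 0 := by rintro rfl; exact hne (by rw [hc, mul_zero])
    have hc1 : 1 ≤ c ^ 2 := by
      have := sq_nonneg c
      have := pow_ne_zero 2 hc0
      omega
    have hz : (s * v - t * u) ^ 2 = 0 := by
      rw [hc] at hid
      have := sq_nonneg (s * v - t * u)
      nlinarith [sq_nonneg Q]
    have hz' : s * v - t * u = 0 := pow_eq_zero_iff two_ne_zero |>.1 hz
    rw [hz, add_zero] at hid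
    have e : s * Q = u * (s * u + t * v) := by
      rw [h2]; linear_combination v * hz'
    have e2 : s ^ 2 * Q ^ 2 = u ^ 2 * Q ^ 2 := by
      rw [← mul_pow, e, mul_pow, hid]
    exact mul_right_cancel₀ (pow_ne_zero 2 hq.ne') e2
  have hprod : (p : ℤ) ^ d ∣ (s * u - t * v) * (s * u + t * v) :=
    ⟨s ^ 2 + u ^ 2 - (p : ℤ) ^ d, by
      have e1 : t ^ 2 = (p : ℤ) ^ d - s ^ 2 := by linarith
      have e2 : v ^ 2 = (p : ℤ) ^ d - u ^ 2 := by linarith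
      calc (s * u - t * v) * (s * u + t * v) = s ^ 2 * u ^ 2 - t ^ 2 * v ^ 2 := by ring
        _ = _ := by rw [e1, e2]; ring⟩
  by_cases hb : (p : ℤ) ∣ s * u + t * v
  · have ha : ¬ (p : ℤ) ∣ s * u - t * v := by
      intro ha
      have h3 : (p : ℤ) ∣ 2 * (s * u) := by
        have := dvd_add ha hb
        ring_nf at this ⊢
        exact this
      rcases hpp.dvd_or_dvd h3 with h | h
      · exact hp2 ((Nat.prime_dvd_prime_iff_eq hp Nat.prime_two).1 (by exact_mod_cast h))
      · rcases hpp.dvd_or_dvd h with h | h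
        · exact hs h
        · exact hu h
    exact key v h2 (hpp.pow_dvd_of_dvd_mul_left d ha hprod)
  · refine key (-v) (by rw [h2]; ring) ?_
    have := hpp.pow_dvd_of_dvd_mul_right d hb hprod
    rwa [mul_neg, ← sub_eq_add_neg]

theorem IsTwoSquareRep.unique {p d q : ℕ} (hp : p.Prime) (hp2 : p ≠ 2) (hq : q = p ^ d)
    {s t u v : ℤ} (h1 : IsTwoSquareRep p q s t) (h2 : IsTwoSquareRep p q u v) : s = u := by
  obtain ⟨e1, n1, m1⟩ := h1
  obtain ⟨e2, n2, m2⟩ := h2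
  rw [hq, Nat.cast_pow] at e1 e2
  have m1' : s % 4 = 1 := m1
  have m2' : u % 4 = 1 := m2
  have h := sq_eq_sq_of_sq_add_sq_eq_prime_pow hp hp2 e1 e2 n1 n2 (by omega) (by omega)
  rcases sq_eq_sq_iff_eq_or_eq_neg.1 h with h | h
  · exact h
  · omega

/-- Descent: -1 is not a square mod p, so p divides both a and b. -/
theorem mul_eq_zero_of_sq_add_sq_eq_prime_pow {p : ℕ} (hp : p.Prime) (hp4 : p % 4 = 3) (e : ℕ)
    (a b : ℤ) (h : a ^ 2 + b ^ 2 = (p : ℤ) ^ (2 * e)) : a * b = 0 := by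
  have := Fact.mk hp
  induction e generalizing a b with
  | zero =>
    by_contra hab
    have ha : 0 < a ^ 2 := by
      have := left_ne_zero_of_mul hab
      positivity
    have hb : 0 < b ^ 2 := by
      have := right_ne_zero_of_mul hab
      positivity
    rw [mul_zero, pow_zero] at h
    omega
  | succ e ih =>
    have hz : (a : ZMod p) ^ 2 + (b : ZMod p) ^ 2 = 0 := by
      have := congrArg (Int.cast : ℤ → ZMod p) h
      push_cast at this
      rw [this, ZMod.natCast_self, zero_pow (by omega)]
    have hb : (b : ZMod p) = 0 := by
      by_contra hb
      exact ZMod.mod_four_ne_three_of_sq_eq_neg_sq' hb (eq_neg_of_add_eq_zero_left hz) hp4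
    have ha : (a : ZMod p) = 0 := by
      rw [hb, zero_pow two_ne_zero, add_zero] at hz
      exact pow_eq_zero_iff two_ne_zero |>.1 hz
    obtain ⟨a', rfl⟩ := (ZMod.intCast_zmod_eq_zero_iff_dvd a p).1 ha
    obtain ⟨b', rfl⟩ := (ZMod.intCast_zmod_eq_zero_iff_dvd b p).1 hb
    have hp0 : (p : ℤ) ^ 2 ≠ 0 := pow_ne_zero 2 (by exact_mod_cast hp.ne_zero)
    have := ih a' b' <| mul_left_cancel₀ hp0 <| by
      rw [show 2 * (e + 1) = 2 + 2 * e by ring, pow_add] at h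
      linear_combination h
    linear_combination (p : ℤ) ^ 2 * this

end TwoSquares

/-! ### Determining S(1) -/

section Evaluation

variable {F : Type*} [Field F] [Fintype F] [DecidableEq F]

theorem quadraticChar_eq_ite {a : F} (ha : a ≠ 0) {P : Prop} [Decidable P] (h : IsSquare a ↔ P) :
    quadraticChar F a = if P then 1 else -1 := by
  split_ifs with hP
  · exact (quadraticChar_one_iff_isSquare ha).2 (h.2 hP)
  · exact quadraticChar_neg_one_iff_not_isSquare.2 (mt h.1 hP)

theorem exists_cubicCharSum_one_eq_two_mul (hF : ringChar F ≠ 2)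
    (h4 : Fintype.card F % 4 = 1) :
    ∃ a b : ℤ, cubicCharSum F 1 = 2 * a ∧ a ^ 2 + b ^ 2 = Fintype.card F := by
  classical
  have h1 : quadraticChar F (-1) = 1 := by
    rw [quadraticChar_eq_ite (neg_ne_zero.2 one_ne_zero) FiniteField.isSquare_neg_one_iff,
      if_pos (by omega)]
  have hN := eight_mul_numNonsquareTriples hF
  rw [h1, sub_self, mul_zero, sub_zero] at hN
  -- 8N = q - 3 - S(1) with q odd, so S(1) is even.
  obtain ⟨a, ha⟩ : ∃ a, cubicCharSum F 1 = 2 * a := ⟨cubicCharSum F 1 / 2, by omega⟩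
  obtain ⟨g, hg⟩ := quadraticChar_exists_neg_one hF
  have hsum := cubicCharSum_one_sq_add_sq hF h1 hg
  have hev : Even (cubicCharSum F g ^ 2) :=
    ⟨2 * Fintype.card F - 2 * a ^ 2, by rw [ha] at hsum; linear_combination hsum⟩
  obtain ⟨b, hb⟩ := (Int.even_pow.1 hev).1
  refine ⟨a, b, ha, ?_⟩
  rw [ha, hb] at hsum
  linarith [show (2 * a) ^ 2 + (b + b) ^ 2 = 4 * (a ^ 2 + b ^ 2) by ring]

/-- The sign c normalises a to s = ca ≡ 1 mod 4; it is 1 for q ≡ 5 and -1 for q ≡ 1 mod 8. -/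
theorem existsUnique_isTwoSquareRep {p d : ℕ} (hp : p.Prime) (hp4 : p % 4 = 1)
    (hF : Fintype.card F = p ^ d) {a b c : ℤ} (hc : c = 1 ∨ c = -1)
    (hS : cubicCharSum F 1 = 2 * a) (hab : a ^ 2 + b ^ 2 = Fintype.card F)
    (hca : c * a ≡ 1 [ZMOD 4]) :
    (∃! s : ℤ, ∃ t : ℤ, IsTwoSquareRep p (Fintype.card F) s t) ∧
      ∀ s t : ℤ, IsTwoSquareRep p (Fintype.card F) s t → cubicCharSum F 1 = 2 * c * s := by
  have hp2 : p ≠ 2 := by rintro rfl; omega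
  have hc2 : c * c = 1 := by rcases hc with rfl | rfl <;> rfl
  have hrep : IsTwoSquareRep p (Fintype.card F) (c * a) b := by
    refine ⟨by rw [← hab]; linear_combination (-a ^ 2) * hc2, fun h => ?_, hca⟩
    apply not_dvd_cubicCharSum_one hp hp4 hF
    rw [hS, show 2 * a = 2 * c * (c * a) by linear_combination (-2 * a) * hc2]
    exact h.mul_left _
  refine ⟨⟨c * a, ⟨b, hrep⟩, fun s ⟨t, ht⟩ => ht.unique hp hp2 hF hrep⟩, fun s t ht => ?_⟩
  rw [ht.unique hp hp2 hF hrep, hS]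
  linear_combination (-2 * a) * hc2

theorem prime_pow_mod_four_of_mod_eq_three {p : ℕ} (hp4 : p % 4 = 3) (e : ℕ) :
    (p : ℤ) ^ e ≡ (-1) ^ e [ZMOD 4] :=
  Int.ModEq.pow e (by rw [Int.ModEq]; omega)

theorem even_of_prime_pow_mod_four {p d : ℕ} (hp4 : p % 4 = 3) (hd : p ^ d % 4 = 1) : Even d := by
  by_contra h
  have h1 := prime_pow_mod_four_of_mod_eq_three hp4 d
  rw [(Nat.not_even_iff_odd.1 h).neg_one_pow, Int.ModEq, ← Nat.cast_pow] at h1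
  omega

theorem prime_mod_four_of_pow_mod_eight {p d : ℕ} (hd : p ^ d % 8 = 5) : p % 4 = 1 := by
  rcases Nat.even_or_odd d with ⟨k, rfl⟩ | ⟨k, rfl⟩
  · rw [← two_mul, pow_mul', sq, Nat.mul_mod] at hd
    have : p ^ k % 8 < 8 := Nat.mod_lt _ (by norm_num)
    interval_cases p ^ k % 8 <;> omega
  · rw [pow_succ, pow_mul', sq, Nat.mul_mod, Nat.mul_mod (p ^ k)] at hd
    have h1 : p ^ k % 8 < 8 := Nat.mod_lt _ (by norm_num)
    have h2 : p % 8 < 8 := Nat.mod_lt _ (by norm_num)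
    have h3 : p % 8 = 5 := by
      interval_cases p ^ k % 8 <;> interval_cases p % 8 <;> omega
    omega

theorem eq_neg_of_sq_add_sq_eq_prime_pow {p e : ℕ} (hp : p.Prime) (hp4 : p % 4 = 3) {a b : ℤ}
    (h : a ^ 2 + b ^ 2 = (p : ℤ) ^ (2 * e)) (ha : a ≡ -1 [ZMOD 4]) :
    a = -((-1) ^ e * (p : ℤ) ^ e) := by
  have ha4 : a % 4 = 3 := ha
  have ha0 : a ≠ 0 := by rintro rfl; omega
  have hb : b = 0 :=
    (mul_eq_zero.1 (mul_eq_zero_of_sq_add_sq_eq_prime_pow hp hp4 e a b h)).resolve_left ha0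
  have hpe := prime_pow_mod_four_of_mod_eq_three hp4 e
  rw [hb, zero_pow two_ne_zero, add_zero, pow_mul', sq_eq_sq_iff_eq_or_eq_neg] at h
  rcases neg_one_pow_eq_or ℤ e with h1 | h1 <;> rw [h1, Int.ModEq] at hpe <;> rw [h1] <;> omega

end Evaluation

theorem theorem1p1 (p d q : ℕ) (hp : p.Prime) (hp2 : p ≠ 2) (hq : q = p ^ d)
    (F : Type*) [Field F] [Fintype F] (hF : Fintype.card F = q) :
    -- Case 1
    (q ≡ 7 [MOD 8] →
      (numSquareTriples F : ℚ) = ((q : ℚ) - 7) / 8 ∧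
      (numNonsquareTriples F : ℚ) = ((q : ℚ) - 7) / 8) ∧
    -- Case 2
    (q ≡ 3 [MOD 8] →
      (numSquareTriples F : ℚ) = ((q : ℚ) - 3) / 8 ∧
      (numNonsquareTriples F : ℚ) = ((q : ℚ) - 3) / 8) ∧
    -- Case 3: `s` is unique, `t` is unique up to sign
    (q ≡ 5 [MOD 8] →
      (∃! s : ℤ, ∃ t : ℤ, IsTwoSquareRep p q s t) ∧
      ∀ s t : ℤ, IsTwoSquareRep p q s t →
        (numSquareTriples F : ℚ) = ((q : ℚ) + 2 * s - 7) / 8 ∧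
        (numNonsquareTriples F : ℚ) = ((q : ℚ) - 2 * s - 3) / 8) ∧
    -- Case 4
    (q ≡ 1 [MOD 8] → p ≡ 1 [MOD 4] →
      (∃! s : ℤ, ∃ t : ℤ, IsTwoSquareRep p q s t) ∧
      ∀ s t : ℤ, IsTwoSquareRep p q s t →
        (numSquareTriples F : ℚ) = ((q : ℚ) - 2 * s - 15) / 8 ∧
        (numNonsquareTriples F : ℚ) = ((q : ℚ) + 2 * s - 3) / 8) ∧
    -- Case 5
    (q ≡ 1 [MOD 8] → p ≡ 3 [MOD 4] →
      IsSquare q ∧ Even d ∧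
      (numSquareTriples F : ℝ) = 1 / 8 * ((q : ℝ) - 2 * (-1) ^ (d / 2) * √(q : ℝ) - 15) ∧
      (numNonsquareTriples F : ℝ) = 1 / 8 * ((q : ℝ) + 2 * (-1) ^ (d / 2) * √(q : ℝ) - 3)) := by
  classical
  have := Fact.mk hp
  have hFp : Fintype.card F = p ^ d := hF.trans hq
  have : CharP F p := charP_of_card_eq_prime_pow hFp
  have hchar : ringChar F ≠ 2 := by rwa [ringChar.eq F p]
  have h2 : (2 : F) ≠ 0 := Ring.two_ne_zero hchar
  have hM := eight_mul_numSquareTriples hchar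
  have hN := eight_mul_numNonsquareTriples hchar
  have e1 := quadraticChar_eq_ite (neg_ne_zero.2 (one_ne_zero' F)) FiniteField.isSquare_neg_one_iff
  have e2 := quadraticChar_eq_ite h2 FiniteField.isSquare_two_iff
  have e3 := quadraticChar_eq_ite (neg_ne_zero.2 h2) FiniteField.isSquare_neg_two_iff
  rw [hF] at e1 e2 e3
  rw [e1, e2, e3] at hM
  rw [e1, e3] at hN
  have hzero : q % 4 = 3 → cubicCharSum F 1 = 0 := fun h =>
    cubicCharSum_eq_zero (by rw [e1, if_neg (by omega)]) 1
  have hex := exists_cubicCharSum_one_eq_two_mul hchar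
  rw [hF] at hM hN hex
  have cast_div : ∀ (n : ℕ) (z : ℤ), 8 * (n : ℤ) = z → (n : ℚ) = (z : ℚ) / 8 := by
    intro n z h
    rw [← h]
    push_cast
    ring
  refine ⟨fun h => ?_, fun h => ?_, fun h => ?_, fun h hp4 => ?_, fun h hp4 => ?_⟩
  · have h8 : q % 8 = 7 := h
    have h4 : q % 4 = 3 := by omega
    norm_num [h8, h4, hzero h4] at hM hN
    constructor
    · rw [cast_div _ ((q : ℤ) - 7) (by omega)]; push_cast; rfl
    · rw [cast_div _ ((q : ℤ) - 7) (by omega)]; push_cast; rfl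
  · have h8 : q % 8 = 3 := h
    have h4 : q % 4 = 3 := by omega
    norm_num [h8, h4, hzero h4] at hM hN
    constructor
    · rw [cast_div _ ((q : ℤ) - 3) (by omega)]; push_cast; rfl
    · rw [cast_div _ ((q : ℤ) - 3) (by omega)]; push_cast; rfl
  · have h8 : q % 8 = 5 := h
    have h4 : q % 4 = 1 := by omega
    norm_num [h8, h4] at hM hN
    obtain ⟨a, b, hS, hab⟩ := hex h4
    have hp4 : p % 4 = 1 := prime_mod_four_of_pow_mod_eight (d := d) (by rw [← hq, h8])
    -- `hN` reads 8N = q - 3 - 2a, so q ≡ 5 mod 8 gives a ≡ 1 mod 4.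
    have hrep := existsUnique_isTwoSquareRep (c := 1) hp hp4 hFp (Or.inl rfl) hS (by rw [hF, hab])
      (by rw [Int.ModEq]; omega)
    rw [hF] at hrep
    refine ⟨hrep.1, fun s t hst => ?_⟩
    have hs := hrep.2 s t hst
    constructor
    · rw [cast_div _ ((q : ℤ) + 2 * s - 7) (by omega)]; push_cast; rfl
    · rw [cast_div _ ((q : ℤ) - 2 * s - 3) (by omega)]; push_cast; rfl
  · have h8 : q % 8 = 1 := h
    have h4 : q % 4 = 1 := by omega
    norm_num [h8, h4] at hM hN
    obtain ⟨a, b, hS, hab⟩ := hex h4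
    have hrep := existsUnique_isTwoSquareRep (c := -1) hp hp4 hFp (Or.inr rfl) hS (by rw [hF, hab])
      (by rw [Int.ModEq]; omega)
    rw [hF] at hrep
    refine ⟨hrep.1, fun s t hst => ?_⟩
    have hs := hrep.2 s t hst
    constructor
    · rw [cast_div _ ((q : ℤ) - 2 * s - 15) (by omega)]; push_cast; rfl
    · rw [cast_div _ ((q : ℤ) + 2 * s - 3) (by omega)]; push_cast; rfl
  · have h8 : q % 8 = 1 := h
    have h4 : q % 4 = 1 := by omega
    norm_num [h8, h4] at hM hN
    obtain ⟨a, b, hS, hab⟩ := hex h4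
    have hd : Even d := even_of_prime_pow_mod_four hp4 (by rw [← hq, h4])
    obtain ⟨e, rfl⟩ := hd
    rw [← two_mul] at hq ⊢
    -- `hN` gives a ≡ -1 mod 4, while p^e ≡ (-1)^e mod 4; this fixes the sign of a = ±p^e.
    have ha : a = -((-1) ^ e * (p : ℤ) ^ e) :=
      eq_neg_of_sq_add_sq_eq_prime_pow hp hp4 (by rw [hab, hq, Nat.cast_pow])
        (by rw [Int.ModEq]; omega)
    have hsqrt : √(q : ℝ) = (p : ℝ) ^ e := by
      rw [hq, Nat.cast_pow, pow_mul']
      exact Real.sqrt_sq (by positivity)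
    rw [hS, ha] at hM hN
    have hM' := congrArg (Int.cast : ℤ → ℝ) hM
    have hN' := congrArg (Int.cast : ℤ → ℝ) hN
    push_cast at hM' hN'
    refine ⟨⟨p ^ e, by rw [hq]; ring⟩, even_two_mul e, ?_, ?_⟩
    · rw [hsqrt, Nat.mul_div_cancel_left e two_pos]
      linear_combination hM' / 8
    · rw [hsqrt, Nat.mul_div_cancel_left e two_pos]
      linear_combination hN' / 8
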